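/- Let $K$ be a field, $n\ge 2$, $p=n-1$, and let $m_0,\dots,m_n$ be positive integers with $\gcd(m_0,\dots,m_n)=1$ such that $m_0<m_1<\cdots<m_p$ is an arithmetic sequence and no $m_i$ lies in the semigroup generated by the other ones ($m_n$ is otherwise arbitrary). Let $P$ be the kernel of the $K$-algebra homomorphism $K[x_0,\dots,x_n]\to K[t]$, $x_i\mapsto t^{m_i}$. Put $\Gamma=\sum_{i=0}^{n}\mathbb{N}_0m_i$, $\Gamma'=\sum_{i=0}^{p}\mathbb{N}_0m_i$ and $S=\{\gamma\in\Gamma : \gamma-m_0\notin\Gamma\}$. For an integer $t\ge 0$ write $t=q_tp+r_t$ with $q_t\in\mathbb{Z}$ and $r_t\in\{1,\dots,p\}$, and put $g_t=q_tm_p+m_{r_t}$. Let $u=\min\{t\ge 0: g_t\notin S\}$ and $\upsilon=\min\{b\ge 1: b\,m_n\in\Gamma'\}$. There are unique integers $0\le w\le\upsilon-1$, $0\le z\le u-1$, $\lambda\ge1$, $\mu\ge0$, $\nu\ge2$ with $$g_u=\lambda m_0+wm_n,\qquad \upsilon m_n=\mu m_0+g_z,\qquad g_{u-z}+(\upsilon-w)m_n=\nu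 m_0,$$ where $\nu=\lambda+\mu+1$ if $r_{u-z}<r_u$ and $\nu=\lambda+\mu$ if $r_{u-z}\ge r_u$. Put $q=q_u$, $r=r_u$, $q'=q_{u-z}$, $r'=r_{u-z}$, and define $$\varphi_i=x_{r+i}x_p^{q}-x_0^{\lambda-1}x_ix_n^{w},\qquad \psi_j=x_{r'+j}x_p^{q'}x_n^{\upsilon-w}-x_0^{\nu-1}x_j,\qquad \theta=x_n^{\upsilon}-x_0^{\mu}x_{r_z}x_p^{q_z},$$ (for $z=0$ one has $r_z=p$, $q_z=-1$, and $x_{r_z}x_p^{q_z}$ means $1$), and $\xi_{i,j}=x_ix_j-x_0x_{i+j}$ if $i+j\le p$, $\xi_{i,j}=x_ix_j-x_{i+j-p}x_p$ if $i+j>p$. Then the set of Patil–Singh generators $$\{\varphi_i: 0\le i\le p-r\}\cup\{\psi_j: 0\le j\le p-r'\}\cup\{\theta\}\cup\{\xi_{i,j}: 1\le i\le j\le p-1\}$$ is a Gröbner basis of $P$ with respect to the graded reverse lexicographic order with grading $\mathrm{wt}(x_i)=m_i$ and $x_0<x_1<\cdots<x_n$, that is, the order in which $\prod x_i^{a_i}>\prod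 x_i^{b_i}$ if and only if $\sum a_im_i>\sum b_im_i$, or these sums are equal and the left-most nonzero entry of $(a_0-b_0,\dots,a_n-b_n)$ is negative. It is not a minimal Gröbner basis in general: over every field $K$ there are $n$ and $m_0,\dots,m_n$ as above for which it is not. Here a Gröbner basis $G$ is called minimal if every $f\in G$ has leading coefficient $1$ and no leading monomial $LM(f)$, $f\in G$, lies in the ideal $\langle LM(h): h\in G\setminus\{f\}\rangle$. -/

import Mathlib

open MvPolynomial

namespace PatilSingh

/-! ### The weighted graded reverse lexicographic order -/

/-- The key by which exponent vectors are compared: first the weighted degree `∑ w i * a i`, then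
the vector `-a` lexicographically from the smallest variable `x_0` on. -/
noncomputable def wgrevlexKey {N : ℕ} (w : Fin N → ℕ) (a : Fin N →₀ ℕ) :
    ℕ ×ₗ Lex (Fin N → ℤ) :=
  toLex (Finsupp.weight w a, toLex (fun i => -(a i : ℤ)))

theorem wgrevlexKey_injective {N : ℕ} (w : Fin N → ℕ) :
    Function.Injective (wgrevlexKey w) := by
  intro a b h
  have h2 : (fun i => -(a i : ℤ)) = fun i => -(b i : ℤ) := by
    have := congrArg (fun k => ofLex (ofLex k).2) h
    simpa [wgrevlexKey] using this
  ext i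
  have := congrFun h2 i
  simpa using this

theorem wgrevlexKey_add {N : ℕ} (w : Fin N → ℕ) (a b : Fin N →₀ ℕ) :
    wgrevlexKey w (a + b) = wgrevlexKey w a + wgrevlexKey w b := by
  unfold wgrevlexKey
  rw [← toLex_add, Prod.mk_add_mk, ← toLex_add, map_add]
  congr 3
  funext i
  simp only [Finsupp.coe_add, Pi.add_apply, Nat.cast_add]
  ring

/-- Exponent vectors, ordered by the weighted graded reverse lexicographic order. -/
def WGrevlex {N : ℕ} (_w : Fin N → ℕ) : Type := Fin N →₀ ℕ

noncomputable instance {N : ℕ} (w : Fin N → ℕ) : AddCommMonoid (WGrevlex w) :=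
  inferInstanceAs (AddCommMonoid (Fin N →₀ ℕ))

noncomputable instance {N : ℕ} (w : Fin N → ℕ) : LinearOrder (WGrevlex w) :=
  LinearOrder.lift' (fun a : WGrevlex w => wgrevlexKey w a) (wgrevlexKey_injective w)

theorem WGrevlex.le_def {N : ℕ} {w : Fin N → ℕ} (a b : WGrevlex w) :
    a ≤ b ↔ wgrevlexKey w a ≤ wgrevlexKey w b := Iff.rfl

theorem WGrevlex.lt_def {N : ℕ} {w : Fin N → ℕ} (a b : WGrevlex w) :
    a < b ↔ wgrevlexKey w a < wgrevlexKey w b := Iff.rfl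

instance {N : ℕ} (w : Fin N → ℕ) : IsOrderedAddMonoid (WGrevlex w) where
  add_le_add_left a b h c := by
    rw [WGrevlex.le_def] at h ⊢
    have h1 := wgrevlexKey_add w a c
    have h2 := wgrevlexKey_add w b c
    exact (h1.trans_le (add_le_add_left h _)).trans_eq h2.symm

theorem wgrevlexKey_mono {N : ℕ} (w : Fin N → ℕ) (hw : ∀ i, 0 < w i) {a b : Fin N →₀ ℕ}
    (h : a ≤ b) : wgrevlexKey w a ≤ wgrevlexKey w b := by
  obtain ⟨c, rfl⟩ := exists_add_of_le h
  by_cases hc : c = 0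
  · simp [hc]
  · apply le_of_lt
    rw [wgrevlexKey, wgrevlexKey, Prod.Lex.toLex_lt_toLex]
    left
    obtain ⟨i, hi⟩ := Finsupp.ne_iff.mp hc
    have h1 : c i * w i ≤ Finsupp.weight w c := by
      rw [Finsupp.weight_apply]
      exact Finset.single_le_sum (f := fun i => c i • w i) (fun _ _ => Nat.zero_le _)
        (Finsupp.mem_support_iff.mpr hi)
    have h2 : 0 < c i * w i := Nat.mul_pos (Nat.pos_of_ne_zero hi) (hw i)
    simp only [map_add]
    omega

/-- The graded reverse lexicographic monomial order with grading `wt(x_i) = w i` (positive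
weights) and `x_0 < x_1 < ⋯`. -/
noncomputable def wgrevlex {N : ℕ} (w : Fin N → ℕ) (hw : ∀ i, 0 < w i) :
    MonomialOrder (Fin N) where
  syn := WGrevlex w
  toSyn := { toEquiv := Equiv.refl (Fin N →₀ ℕ), map_add' := fun _ _ => rfl }
  toSyn_monotone _ _ h := wgrevlexKey_mono w hw h
  wellFoundedLT_syn := by
    have : WellQuasiOrderedLE (WGrevlex w) :=
      Monotone.wellQuasiOrderedLE_of_wellQuasiOrderedLE_of_surjective (α := Fin N →₀ ℕ) (β := WGrevlex w)
        (f := fun a => a) (fun _ _ h => wgrevlexKey_mono w hw h) (fun a => ⟨a, rfl⟩)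
    infer_instance

open scoped MonomialOrder in
/-- `x^a < x^b` iff `x^a` has smaller weighted degree, or the weighted degrees agree and the
left-most nonzero entry of `(b_0 - a_0, b_1 - a_1, …)` is negative. -/
theorem wgrevlex_lt_iff {N : ℕ} (w : Fin N → ℕ) (hw : ∀ i, 0 < w i) (a b : Fin N →₀ ℕ) :
    a ≺[wgrevlex w hw] b ↔ ∑ i, a i * w i < ∑ i, b i * w i ∨
      (∑ i, a i * w i = ∑ i, b i * w i ∧ ∃ i, (∀ j < i, b j = a j) ∧ b i < a i) := by
  have hwt : ∀ c : Fin N →₀ ℕ, Finsupp.weight w c = ∑ i, c i * w i := by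
    intro c
    rw [Finsupp.weight_apply, Finsupp.sum_fintype _ _ (by simp)]
    simp
  have h1 : a ≺[wgrevlex w hw] b ↔ wgrevlexKey w a < wgrevlexKey w b := Iff.rfl
  rw [h1, wgrevlexKey, wgrevlexKey, Prod.Lex.toLex_lt_toLex, hwt, hwt]
  refine or_congr Iff.rfl (and_congr Iff.rfl ?_)
  constructor
  · rintro ⟨i, hi, hlt⟩
    refine ⟨i, fun j hj => ?_, ?_⟩
    · have h2 : -(a j : ℤ) = -(b j : ℤ) := hi j hj
      omega
    · have h2 : -(a i : ℤ) < -(b i : ℤ) := hlt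
      omega
  · rintro ⟨i, hi, hlt⟩
    refine ⟨i, fun j hj => ?_, ?_⟩
    · change -(a j : ℤ) = -(b j : ℤ)
      have := hi j hj
      omega
    · change -(a i : ℤ) < -(b i : ℤ)
      omega

/-! ### Gröbner bases -/

/-- A finite subset `G` of `I` whose leading terms generate the ideal generated by the leading
terms of all elements of `I`. -/
def IsGroebnerBasis {σ K : Type*} [Field K] (ord : MonomialOrder σ)
    (G : Set (MvPolynomial σ K)) (I : Ideal (MvPolynomial σ K)) : Prop :=
  G.Finite ∧ G ⊆ I ∧
    Ideal.span (ord.leadingTerm '' G) =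
      Ideal.span (ord.leadingTerm '' (I : Set (MvPolynomial σ K)))

/-- A minimal Gröbner basis: all leading coefficients are `1`, and no leading monomial lies in the
ideal generated by the leading monomials of the other elements. -/
def IsMinimalGroebnerBasis {σ K : Type*} [Field K] (ord : MonomialOrder σ)
    (G : Set (MvPolynomial σ K)) (I : Ideal (MvPolynomial σ K)) : Prop :=
  IsGroebnerBasis ord G I ∧ (∀ f ∈ G, ord.leadingCoeff f = 1) ∧
    ∀ f ∈ G, monomial (ord.degree f) (1 : K) ∉
      Ideal.span ((fun h => monomial (ord.degree h) (1 : K)) '' (G \ {f}))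

/-! ### The monomial curve

Throughout, `n = p + 1`, so that the variables are `x_0, …, x_p, x_n`, indexed by `Fin (p + 2)`. -/

/-- The number `k ≤ p + 1`, as an index. -/
def idx (p k : ℕ) : Fin (p + 2) := Fin.ofNat (p + 2) k

/-- The standing assumptions on `m_0, …, m_p, m_n`: positive integers, `m_0 < ⋯ < m_p` an
arithmetic sequence, greatest common divisor `1`, and no `m_i` lies in the semigroup generated by
the others. -/
structure IsAlmostArithmetic {p : ℕ} (m : Fin (p + 2) → ℕ) : Prop where
  one_le : 1 ≤ p
  pos : ∀ i, 0 < m i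
  arith : ∃ d, 0 < d ∧ ∀ k ≤ p, m (idx p k) = m (idx p 0) + k * d
  gcd_eq_one : Finset.univ.gcd m = 1
  minimal : ∀ i, m i ∉ AddSubmonoid.closure (m '' {i}ᶜ)

/-- The kernel of `K[x_0, …, x_n] → K[t]`, `x_i ↦ t ^ m_i`. -/
noncomputable def toricIdeal (K : Type*) [Field K] {p : ℕ} (m : Fin (p + 2) → ℕ) :
    Ideal (MvPolynomial (Fin (p + 2)) K) :=
  RingHom.ker (aeval (fun i => (Polynomial.X : Polynomial K) ^ m i) :
    MvPolynomial (Fin (p + 2)) K →ₐ[K] Polynomial K)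

/-- The semigroup `Γ` generated by `m_0, …, m_n`, inside `ℤ`. -/
def Gam {p : ℕ} (m : Fin (p + 2) → ℕ) : AddSubmonoid ℤ :=
  AddSubmonoid.closure (Set.range fun i => (m i : ℤ))

/-- The semigroup `Γ'` generated by `m_0, …, m_p`, inside `ℤ`. -/
def Gam' {p : ℕ} (m : Fin (p + 2) → ℕ) : AddSubmonoid ℤ :=
  AddSubmonoid.closure {a | ∃ k ≤ p, a = (m (idx p k) : ℤ)}

/-- The set `S` of all `γ ∈ Γ` with `γ - m_0 ∉ Γ`. -/
def apery {p : ℕ} (m : Fin (p + 2) → ℕ) : Set ℤ :=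
  {γ | γ ∈ Gam m ∧ γ - m (idx p 0) ∉ Gam m}

/-- `q_t`, where `t = q_t p + r_t` with `1 ≤ r_t ≤ p`; in particular `q_0 = -1`. -/
def quo (p t : ℕ) : ℤ := ((t : ℤ) - 1) / p

/-- `r_t`, where `t = q_t p + r_t` with `1 ≤ r_t ≤ p`; in particular `r_0 = p`. -/
def rem (p t : ℕ) : ℕ := (t + p - 1) % p + 1

theorem quo_rem_spec {p : ℕ} (hp : 1 ≤ p) (t : ℕ) :
    (t : ℤ) = quo p t * p + rem p t ∧ 1 ≤ rem p t ∧ rem p t ≤ p := by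
  have hlt : (t + p - 1) % p < p := Nat.mod_lt _ hp
  refine ⟨?_, by unfold rem; omega, by unfold rem; omega⟩
  have h1 : ((rem p t : ℕ) : ℤ) = ((t : ℤ) - 1) % p + 1 := by
    unfold rem
    have h2 : ((t + p - 1 : ℕ) : ℤ) = ((t : ℤ) - 1) + p := by omega
    push_cast
    rw [h2, Int.add_emod_right]
  rw [h1, quo]
  have := Int.mul_ediv_add_emod ((t : ℤ) - 1) p
  linarith

theorem quo_rem_unique {p : ℕ} (hp : 1 ≤ p) (t : ℕ) (q : ℤ) (r : ℕ)
    (h : (t : ℤ) = q * p + r) (h1 : 1 ≤ r) (h2 : r ≤ p) : q = quo p t ∧ r = rem p t := by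
  obtain ⟨e, e1, e2⟩ := quo_rem_spec hp t
  have hq : q = quo p t := by
    have h3 : (q - quo p t) * p = (rem p t : ℤ) - r := by linarith
    have h4 : |(rem p t : ℤ) - r| < p := by rw [abs_lt]; constructor <;> omega
    rw [← h3, abs_mul, Nat.abs_cast] at h4
    have h5 : |q - quo p t| < 1 := by
      by_contra hc
      have : (p : ℤ) ≤ |q - quo p t| * p := le_mul_of_one_le_left (by omega) (by omega)
      omega
    have := Int.abs_lt_one_iff.mp h5
    omega
  refine ⟨hq, ?_⟩
  rw [hq] at h
  omega

/-- `g_t = q_t m_p + m_{r_t}`. -/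
def g {p : ℕ} (m : Fin (p + 2) → ℕ) (t : ℕ) : ℤ :=
  quo p t * m (idx p p) + m (idx p (rem p t))

/-- The parameters `u, υ, w, z, λ, μ, ν` of the sequence. -/
structure Params where
  u : ℕ
  v : ℕ
  w : ℕ
  z : ℕ
  lam : ℕ
  mu : ℕ
  nu : ℕ

/-- The conditions that define the parameters. -/
structure IsParams {p : ℕ} (m : Fin (p + 2) → ℕ) (d : Params) : Prop where
  u_least : IsLeast {t : ℕ | g m t ∉ apery m} d.u
  v_least : IsLeast {b : ℕ | 1 ≤ b ∧ (b : ℤ) * m (idx p (p + 1)) ∈ Gam' m} d.v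
  w_lt : d.w < d.v
  z_lt : d.z < d.u
  one_le_lam : 1 ≤ d.lam
  two_le_nu : 2 ≤ d.nu
  g_u : g m d.u = d.lam * m (idx p 0) + d.w * m (idx p (p + 1))
  v_mul : (d.v : ℤ) * m (idx p (p + 1)) = d.mu * m (idx p 0) + g m d.z
  g_u_sub_z : g m (d.u - d.z) + ((d.v : ℤ) - d.w) * m (idx p (p + 1)) = d.nu * m (idx p 0)
  nu_eq : d.nu = if rem p (d.u - d.z) < rem p d.u then d.lam + d.mu + 1 else d.lam + d.mu

/-! ### The Patil–Singh generators -/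

/-- The variable `x_k`, for `k ≤ p + 1`. -/
noncomputable abbrev x (K : Type*) [Field K] (p k : ℕ) : MvPolynomial (Fin (p + 2)) K :=
  X (idx p k)

/-- The monomial `x_{r_t} x_p ^ {q_t}`; for `t = 0` it is `x_p x_p ^ {-1} = 1`. -/
noncomputable def gMonomial (K : Type*) [Field K] (p t : ℕ) : MvPolynomial (Fin (p + 2)) K :=
  if t = 0 then 1 else x K p (rem p t) * x K p p ^ (quo p t).toNat

/-- `φ_i = x_{r+i} x_p^q - x_0^{λ-1} x_i x_n^w`, where `q = q_u` and `r = r_u`. -/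
noncomputable def phi (K : Type*) [Field K] (p : ℕ) (d : Params) (i : ℕ) :
    MvPolynomial (Fin (p + 2)) K :=
  x K p (rem p d.u + i) * x K p p ^ (quo p d.u).toNat
    - x K p 0 ^ (d.lam - 1) * x K p i * x K p (p + 1) ^ d.w

/-- `ψ_j = x_{r'+j} x_p^{q'} x_n^{υ-w} - x_0^{ν-1} x_j`, where `q' = q_{u-z}` and
`r' = r_{u-z}`. -/
noncomputable def psi (K : Type*) [Field K] (p : ℕ) (d : Params) (j : ℕ) :
    MvPolynomial (Fin (p + 2)) K :=
  x K p (rem p (d.u - d.z) + j) * x K p p ^ (quo p (d.u - d.z)).toNat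
      * x K p (p + 1) ^ (d.v - d.w)
    - x K p 0 ^ (d.nu - 1) * x K p j

/-- `θ = x_n^υ - x_0^μ x_{r_z} x_p^{q_z}`. -/
noncomputable def theta (K : Type*) [Field K] (p : ℕ) (d : Params) :
    MvPolynomial (Fin (p + 2)) K :=
  x K p (p + 1) ^ d.v - x K p 0 ^ d.mu * gMonomial K p d.z

/-- `ξ_{i,j} = x_i x_j - x_0 x_{i+j}` if `i + j ≤ p`, and `x_i x_j - x_{i+j-p} x_p` otherwise. -/
noncomputable def xi (K : Type*) [Field K] (p i j : ℕ) : MvPolynomial (Fin (p + 2)) K :=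
  if i + j ≤ p then x K p i * x K p j - x K p 0 * x K p (i + j)
  else x K p i * x K p j - x K p (i + j - p) * x K p p

/-- The set of Patil–Singh generators. -/
def generators (K : Type*) [Field K] (p : ℕ) (d : Params) :
    Set (MvPolynomial (Fin (p + 2)) K) :=
  {f | ∃ i, i ≤ p - rem p d.u ∧ f = phi K p d i} ∪
  {f | ∃ j, j ≤ p - rem p (d.u - d.z) ∧ f = psi K p d j} ∪
  {theta K p d} ∪
  {f | ∃ i j, 1 ≤ i ∧ i ≤ j ∧ j ≤ p - 1 ∧ f = xi K p i j}

end PatilSingh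

namespace PatilSingh

/-! Write `e` for the common difference. Then g_t = (q_t + 1) m_0 + t e, so modulo m_0 the monomial
x_0^c x_{r_t} x_p^{q_t} x_n^b has weight t e + b m_n. Each generator is a binomial of two terms of
equal weight whose first term is the leading one (`relations_isRelation`). A monomial divisible by
no leading monomial of some ξ has the displayed form for some t (`exists_eq_gExp`). The leading
monomials of φ, θ and ψ then exclude t ≥ u, b ≥ υ, and the corner where t ≥ u - z and b ≥ υ - w
(`exists_standard_form`).

On the remaining L-shaped region the residues t e + b m_n modulo m_0 are pairwise distinct
(`IsParams.eq_of_residue_eq`). This rests on `eq_zero_of_g_eq`: minimality of u and υ forbids s e ≡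
c m_n with 0 ≤ s < u and 0 ≤ c < υ, unless s = c = 0. Hence standard monomials of equal weight
coincide. This suffices for a Gröbner basis (`isGroebnerBasis_of_relations`): a standard leading
monomial of an element of P would share its weight with a smaller monomial, hence with a smaller
standard one.

Minimality fails whenever w = 0, since then LM(θ) = x_n^υ divides LM(ψ_0); the sequence 4, 6, 7 is
an instance over every field. -/

theorem quo_zero {p : ℕ} (hp : 1 ≤ p) : quo p 0 = -1 := by
  have := (quo_rem_unique hp 0 (-1) p (by push_cast; ring) hp le_rfl).1
  exact this.symm

theorem quo_nonneg {p : ℕ} (t : ℕ) (ht : 1 ≤ t) : 0 ≤ quo p t :=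
  Int.ediv_nonneg (by omega) (by omega)

theorem quo_mono {p s t : ℕ} (hp : 1 ≤ p) (h : s ≤ t) : quo p s ≤ quo p t :=
  Int.ediv_le_ediv (by omega) (by omega)

/-- The number q_t + 1 is the ceiling of t / p. Ceilings add up exactly or with an excess of 1, and
the excess occurs when r_s + r_t ≤ p, that is, when r_s < r_{s+t}. This is the source of the two
cases for ν. -/
theorem quo_add {p : ℕ} (hp : 1 ≤ p) (s t : ℕ) :
    quo p s + 1 + (quo p t + 1) =
      quo p (s + t) + 1 + if rem p s < rem p (s + t) then 1 else 0 := by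
  obtain ⟨hs, hs1, hs2⟩ := quo_rem_spec hp s
  obtain ⟨ht, ht1, ht2⟩ := quo_rem_spec hp t
  by_cases h : rem p s + rem p t ≤ p
  · obtain ⟨h1, h2⟩ := quo_rem_unique hp (s + t) (quo p s + quo p t) (rem p s + rem p t)
      (by push_cast; linarith) (by omega) h
    rw [if_pos (by omega)]
    omega
  · obtain ⟨h1, h2⟩ := quo_rem_unique hp (s + t) (quo p s + quo p t + 1) (rem p s + rem p t - p)
      (by rw [Nat.cast_sub (by omega)]; push_cast; linarith) (by omega) (by omega)
    rw [if_neg (by omega)]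
    omega

/-! ### The numbers g_t, the semigroups, and the parameters -/

section Numbers

variable {p : ℕ} {m : Fin (p + 2) → ℕ} {e : ℕ}

theorem g_eq (hp : 1 ≤ p) (he : ∀ k ≤ p, m (idx p k) = m (idx p 0) + k * e) (t : ℕ) :
    g m t = (quo p t + 1) * m (idx p 0) + t * e := by
  obtain ⟨h, -, h2⟩ := quo_rem_spec hp t
  rw [g, he p le_rfl, he _ h2]
  push_cast
  linear_combination (-(e : ℤ)) * h

theorem g_zero (hp : 1 ≤ p) (he : ∀ k ≤ p, m (idx p k) = m (idx p 0) + k * e) : g m 0 = 0 := by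
  rw [g_eq hp he, quo_zero hp]
  simp

theorem g_add (hp : 1 ≤ p) (he : ∀ k ≤ p, m (idx p k) = m (idx p 0) + k * e) (s t : ℕ) :
    g m s + g m t =
      g m (s + t) + (if rem p s < rem p (s + t) then 1 else 0) * m (idx p 0) := by
  have h := quo_add hp s t
  rw [g_eq hp he, g_eq hp he, g_eq hp he]
  push_cast
  linear_combination (m (idx p 0) : ℤ) * h

theorem exists_g_add (hp : 1 ≤ p) (he : ∀ k ≤ p, m (idx p k) = m (idx p 0) + k * e) (s t : ℕ) :
    ∃ a : ℕ, a ≤ 1 ∧ g m s + g m t = g m (s + t) + a * m (idx p 0) := by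
  have h := g_add hp he s t
  split_ifs at h
  · exact ⟨1, le_rfl, by simpa using h⟩
  · exact ⟨0, by omega, by simpa using h⟩

theorem le_g (hp : 1 ≤ p) (he : ∀ k ≤ p, m (idx p k) = m (idx p 0) + k * e) {t : ℕ}
    (ht : 1 ≤ t) : (m (idx p 0) : ℤ) + e ≤ g m t := by
  rw [g_eq hp he]
  have h := quo_nonneg (p := p) t ht
  have h1 : (0 : ℤ) ≤ quo p t * m (idx p 0) := by positivity
  have h2 : (1 : ℤ) * e ≤ t * e := by gcongr; exact_mod_cast ht
  linarith

theorem g_of_le (hp : 1 ≤ p) {k : ℕ} (hk : 1 ≤ k) (hkp : k ≤ p) : g m k = m (idx p k) := by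
  obtain ⟨h1, h2⟩ := quo_rem_unique hp k 0 k (by simp) hk hkp
  simp [g, ← h1, ← h2]

/-- A sum g_s + g_t differs from g_{s+t} by 0 or m_0, so the numbers a m_0 + g_t are already closed
under addition. -/
theorem mem_Gam'_iff (hp : 1 ≤ p) (he : ∀ k ≤ p, m (idx p k) = m (idx p 0) + k * e) (y : ℤ) :
    y ∈ Gam' m ↔ ∃ a t : ℕ, y = a * m (idx p 0) + g m t := by
  constructor
  · intro h
    induction h using AddSubmonoid.closure_induction with
    | mem y hy =>
      obtain ⟨k, hk, rfl⟩ := hy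
      rcases Nat.eq_zero_or_pos k with rfl | h
      · exact ⟨1, 0, by simp [g_zero hp he]⟩
      · exact ⟨0, k, by simp [g_of_le hp h hk]⟩
    | zero => exact ⟨0, 0, by simp [g_zero hp he]⟩
    | add y y' _ _ h h' =>
      obtain ⟨a, t, rfl⟩ := h
      obtain ⟨a', t', rfl⟩ := h'
      obtain ⟨c, -, hc⟩ := exists_g_add hp he t t'
      refine ⟨a + a' + c, t + t', ?_⟩
      push_cast
      linear_combination hc
  · rintro ⟨a, t, rfl⟩
    have hmem : ∀ k ≤ p, (m (idx p k) : ℤ) ∈ Gam' m := fun k hk =>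
      AddSubmonoid.subset_closure ⟨k, hk, rfl⟩
    refine add_mem ?_ ?_
    · simpa using (Gam' m).nsmul_mem (hmem 0 (by omega)) a
    · rcases Nat.eq_zero_or_pos t with rfl | h
      · rw [g_zero hp he]
        exact zero_mem _
      · obtain ⟨q, hq⟩ := Int.eq_ofNat_of_zero_le (quo_nonneg (p := p) t h)
        rw [g, hq]
        refine add_mem ?_ (hmem _ (quo_rem_spec hp t).2.2)
        simpa using (Gam' m).nsmul_mem (hmem p le_rfl) q

theorem exists_idx_eq (i : Fin (p + 2)) : ∃ k, k ≤ p + 1 ∧ idx p k = i :=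
  ⟨i, by omega, by ext; simp [idx]⟩

theorem Gam'_le_Gam : Gam' m ≤ Gam m := by
  apply AddSubmonoid.closure_mono
  rintro y ⟨k, -, rfl⟩
  exact ⟨_, rfl⟩

theorem mem_Gam_iff (hp : 1 ≤ p) (he : ∀ k ≤ p, m (idx p k) = m (idx p 0) + k * e) (y : ℤ) :
    y ∈ Gam m ↔ ∃ a t b : ℕ, y = a * m (idx p 0) + g m t + b * m (idx p (p + 1)) := by
  constructor
  · intro h
    induction h using AddSubmonoid.closure_induction with
    | mem y hy =>
      obtain ⟨i, rfl⟩ := hy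
      obtain ⟨k, hk, rfl⟩ := exists_idx_eq i
      rcases Nat.lt_or_ge k (p + 1) with h | h
      · obtain ⟨a, t, h⟩ := (mem_Gam'_iff hp he (m (idx p k))).1
          (AddSubmonoid.subset_closure ⟨k, by omega, rfl⟩)
        exact ⟨a, t, 0, by simpa using h⟩
      · obtain rfl : k = p + 1 := by omega
        exact ⟨0, 0, 1, by simp [g_zero hp he]⟩
    | zero => exact ⟨0, 0, 0, by simp [g_zero hp he]⟩
    | add y y' _ _ h h' =>
      obtain ⟨a, t, b, rfl⟩ := h
      obtain ⟨a', t', b', rfl⟩ := h'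
      obtain ⟨c, -, hc⟩ := exists_g_add hp he t t'
      refine ⟨a + a' + c, t + t', b + b', ?_⟩
      push_cast
      linear_combination hc
  · rintro ⟨a, t, b, rfl⟩
    refine add_mem (Gam'_le_Gam ((mem_Gam'_iff hp he _).2 ⟨a, t, rfl⟩)) ?_
    simpa using (Gam m).nsmul_mem (AddSubmonoid.subset_closure ⟨idx p (p + 1), rfl⟩) b

theorem notMem_apery_iff (hp : 1 ≤ p) (he : ∀ k ≤ p, m (idx p k) = m (idx p 0) + k * e) (t : ℕ) :
    g m t ∉ apery m ↔ ∃ a s b : ℕ,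
      g m t = (a + 1 : ℕ) * m (idx p 0) + g m s + b * m (idx p (p + 1)) := by
  have h : g m t ∈ Gam m := (mem_Gam_iff hp he _).2 ⟨0, t, 0, by simp⟩
  have h1 : g m t ∉ apery m ↔ g m t - m (idx p 0) ∈ Gam m :=
    not_and_not_right.trans ⟨fun h' => h' h, fun h' _ => h'⟩
  rw [h1, mem_Gam_iff hp he]
  constructor
  · rintro ⟨a, s, b, hh⟩
    exact ⟨a, s, b, by push_cast; linear_combination hh⟩
  · rintro ⟨a, s, b, hh⟩
    exact ⟨a, s, b, by push_cast at hh; linear_combination hh⟩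

theorem exists_isLeast_u (hp : 1 ≤ p) (hpos : ∀ i, 0 < m i)
    (he : ∀ k ≤ p, m (idx p k) = m (idx p 0) + k * e) :
    ∃ u, IsLeast {t : ℕ | g m t ∉ apery m} u := by
  have hne : {t : ℕ | g m t ∉ apery m}.Nonempty := by
    refine ⟨m (idx p 0), (notMem_apery_iff hp he _).2 ?_⟩
    obtain ⟨q, hq⟩ := Int.eq_ofNat_of_zero_le (quo_nonneg (p := p) (m (idx p 0)) (hpos _))
    -- For t = m_0 the term t e is itself a multiple of m_0, so g_t = (q_t + 1 + e) m_0.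
    refine ⟨q + e, 0, 0, ?_⟩
    rw [g_zero hp he, g_eq hp he, hq]
    push_cast
    ring
  exact ⟨_, Nat.sInf_mem hne, fun _ h => Nat.sInf_le h⟩

theorem exists_isLeast_v (hpos : ∀ i, 0 < m i) :
    ∃ v, IsLeast {b : ℕ | 1 ≤ b ∧ (b : ℤ) * m (idx p (p + 1)) ∈ Gam' m} v := by
  have hne : {b : ℕ | 1 ≤ b ∧ (b : ℤ) * m (idx p (p + 1)) ∈ Gam' m}.Nonempty := by
    refine ⟨m (idx p 0), hpos _, ?_⟩
    have h := (Gam' m).nsmul_mem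
      (AddSubmonoid.subset_closure ⟨0, by omega, rfl⟩ : (m (idx p 0) : ℤ) ∈ Gam' m)
      (m (idx p (p + 1)))
    rw [mul_comm]
    simpa using h
  exact ⟨_, Nat.sInf_mem hne, fun _ h => Nat.sInf_le h⟩

/-- A representation of `g_u - m_0` in the semigroup involves only `m_0` and `m_n`. -/
theorem eq_zero_of_g_u_eq (hp : 1 ≤ p) (he : ∀ k ≤ p, m (idx p k) = m (idx p 0) + k * e)
    (hpos : ∀ i, 0 < m i) {u : ℕ} (hu : IsLeast {t : ℕ | g m t ∉ apery m} u) {a s b : ℕ}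
    (h : g m u = (a + 1 : ℕ) * m (idx p 0) + g m s + b * m (idx p (p + 1))) : s = 0 := by
  by_contra hs
  have h0 : (0 : ℤ) < m (idx p 0) := by exact_mod_cast hpos _
  -- If s < u, moving g_s to the other side shows g_{u-s} ∉ S, against the minimality of u. If s ≥
  -- u, then g_s ≥ g_u and the right side is too large.
  rcases Nat.lt_or_ge s u with hsu | hsu
  · obtain ⟨c, -, hc⟩ := exists_g_add hp he s (u - s)
    rw [Nat.add_sub_cancel' hsu.le] at hc
    have h1 : g m (u - s) ∉ apery m := by
      refine (notMem_apery_iff hp he _).2 ⟨a + c, 0, b, ?_⟩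
      rw [g_zero hp he]
      push_cast at h ⊢
      linear_combination h + hc
    have := hu.2 h1
    omega
  · obtain ⟨c, hc1, hc⟩ := exists_g_add hp he u (s - u)
    rw [Nat.add_sub_cancel' hsu] at hc
    have hb : (0 : ℤ) ≤ b * m (idx p (p + 1)) := by positivity
    have ha : (0 : ℤ) ≤ a * m (idx p 0) := by positivity
    have hc2 : (c : ℤ) * m (idx p 0) ≤ 1 * m (idx p 0) := by
      gcongr; exact_mod_cast hc1
    push_cast at h
    rcases Nat.eq_zero_or_pos (s - u) with h' | h'
    · rw [show s = u by omega] at h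
      linarith
    · have := le_g hp he h'
      have h3 : (0 : ℤ) ≤ e := by positivity
      linarith

/-- Among all representations, w and z are taken least; this is what gives w < υ and z < u. The
equation with ν is the difference of those for υ m_n and g_u, corrected by the carry in g_{u-z} +
g_z. -/
theorem exists_isParams (hm : IsAlmostArithmetic m) : ∃ d, IsParams m d := by
  have hp := hm.one_le
  have hpos := hm.pos
  obtain ⟨e, he0, he⟩ := hm.arith
  have h0 : (0 : ℤ) < m (idx p 0) := by exact_mod_cast hpos _
  obtain ⟨u, hu⟩ := exists_isLeast_u hp hpos he
  obtain ⟨v, hv⟩ := exists_isLeast_v hpos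
  have hW : ∃ w : ℕ, ∃ a : ℕ, g m u = (a + 1 : ℕ) * m (idx p 0) + w * m (idx p (p + 1)) := by
    obtain ⟨a, s, b, h⟩ := (notMem_apery_iff hp he _).1 hu.1
    obtain rfl := eq_zero_of_g_u_eq hp he hpos hu h
    exact ⟨b, a, by simpa [g_zero hp he] using h⟩
  classical
  obtain ⟨a, hw⟩ := Nat.find_spec hW
  have hwmin := fun n => Nat.find_min' hW (m := n)
  set w := Nat.find hW
  have hZ : ∃ z : ℕ, ∃ a : ℕ, (v : ℤ) * m (idx p (p + 1)) = a * m (idx p 0) + g m z := by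
    obtain ⟨a, t, h⟩ := (mem_Gam'_iff hp he _).1 hv.1.2
    exact ⟨t, a, h⟩
  obtain ⟨mu, hz⟩ := Nat.find_spec hZ
  have hzmin := fun n => Nat.find_min' hZ (m := n)
  set z := Nat.find hZ
  have hv1 : 1 ≤ v := hv.1.1
  -- Otherwise υ m_n could be replaced by μ m_0 + g_z; then z = 0 is forced, and w - υ contradicts
  -- the choice of w.
  have hwv : w < v := by
    by_contra hcon
    have h1 : g m u = (a + mu + 1 : ℕ) * m (idx p 0) + g m z +
        (w - v : ℕ) * m (idx p (p + 1)) := by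
      rw [Nat.cast_sub (by omega)]
      push_cast at hw ⊢
      linear_combination hw + hz
    have h2 := eq_zero_of_g_u_eq hp he hpos hu h1
    rw [h2, g_zero hp he, add_zero] at h1
    have := hwmin _ ⟨_, h1⟩
    omega
  have hu1 : 1 ≤ u := by
    by_contra hcon
    obtain rfl : u = 0 := by omega
    rw [g_zero hp he] at hw
    push_cast at hw
    have : (0 : ℤ) ≤ a * m (idx p 0) := by positivity
    have : (0 : ℤ) ≤ w * m (idx p (p + 1)) := by positivity
    linarith
  -- Otherwise g_u can be split off from g_z, which puts (υ - w) m_n in Γ'. This contradicts the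
  -- choice of z if w = 0, and that of υ if w > 0.
  have hzu : z < u := by
    by_contra hcon
    obtain ⟨c, hc1, hc⟩ := exists_g_add hp he u (z - u)
    rw [Nat.add_sub_cancel' (by omega)] at hc
    have h1 : ((v - w : ℕ) : ℤ) * m (idx p (p + 1)) =
        (mu + (a + 1 - c) : ℕ) * m (idx p 0) + g m (z - u) := by
      rw [Nat.cast_sub hwv.le, Nat.cast_add, Nat.cast_sub (by omega)]
      push_cast at hw ⊢
      linear_combination hz - hc + hw
    rcases Nat.eq_zero_or_pos w with hw0 | hw0
    · rw [hw0, Nat.sub_zero] at h1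
      have := hzmin _ ⟨_, h1⟩
      omega
    · have : v ≤ v - w := hv.2 ⟨by omega, (mem_Gam'_iff hp he _).2 ⟨_, _, h1⟩⟩
      omega
  have hsum := g_add hp he (u - z) z
  rw [Nat.sub_add_cancel hzu.le] at hsum
  obtain ⟨nu, hnu⟩ : ∃ nu : ℕ,
      nu = if rem p (u - z) < rem p u then a + 1 + mu + 1 else a + 1 + mu := ⟨_, rfl⟩
  have hnu' : g m (u - z) + ((v : ℤ) - w) * m (idx p (p + 1)) = nu * m (idx p 0) := by
    rw [hnu]
    push_cast at hw
    split_ifs at hsum ⊢ <;> push_cast <;> linear_combination hsum + hz + hw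
  have hnu2 : 2 ≤ nu := by
    by_contra hcon
    have h1 := le_g hp he (t := u - z) (by omega)
    have h2 : (0 : ℤ) ≤ ((v : ℤ) - w) * m (idx p (p + 1)) :=
      mul_nonneg (by omega) (by positivity)
    have h3 : (nu : ℤ) * m (idx p 0) ≤ 1 * m (idx p 0) := by
      gcongr
      omega
    have h4 : (0 : ℤ) < e := by exact_mod_cast he0
    linarith
  exact ⟨⟨u, v, w, z, a + 1, mu, nu⟩, hu, hv, hwv, hzu, by simp, hnu2, hw, hz, hnu', hnu⟩

/-- No lattice vector `(s, -c)` with `0 ≤ s < u` and `0 ≤ c < v` besides `0`. -/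
theorem eq_zero_of_g_eq (hp : 1 ≤ p) (he : ∀ k ≤ p, m (idx p k) = m (idx p 0) + k * e)
    (hpos : ∀ i, 0 < m i) {u v : ℕ} (hu : IsLeast {t : ℕ | g m t ∉ apery m} u)
    (hv : IsLeast {b : ℕ | 1 ≤ b ∧ (b : ℤ) * m (idx p (p + 1)) ∈ Gam' m} v) {s c : ℕ} {k : ℤ}
    (hs : s < u) (hc : c < v) (h : (s : ℤ) * e = c * m (idx p (p + 1)) + k * m (idx p 0)) :
    s = 0 ∧ c = 0 := by
  have h0 : (0 : ℤ) < m (idx p 0) := by exact_mod_cast hpos _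
  have hg := g_eq hp he s
  have hg' : g m s = c * m (idx p (p + 1)) + (k + (quo p s + 1)) * m (idx p 0) := by
    rw [hg]; linear_combination h
  set l := k + (quo p s + 1)
  -- In g_s = c m_n + l m_0, a positive l would give g_s ∉ S with s < u. For l ≤ 0 the multiple c
  -- m_n lies in Γ', so c < υ forces c = 0; then g_s ≤ 0 forces s = 0.
  have hl : l ≤ 0 := by
    by_contra hcon
    obtain ⟨n, hn⟩ := Int.eq_ofNat_of_zero_le (a := l - 1) (by omega)
    have : g m s ∉ apery m := (notMem_apery_iff hp he s).2 ⟨n, 0, c, by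
      rw [g_zero hp he, hg', show l = n + 1 by omega]; push_cast; ring⟩
    have := hu.2 this
    omega
  obtain ⟨n, hn⟩ := Int.eq_ofNat_of_zero_le (a := -l) (by omega)
  have hc0 : c = 0 := by
    by_contra hcon
    have : v ≤ c := hv.2 ⟨by omega, (mem_Gam'_iff hp he _).2 ⟨n, s, by
      rw [hg', show l = -n by omega]; ring⟩⟩
    omega
  refine ⟨?_, hc0⟩
  by_contra hcon
  have h1 := le_g hp he (t := s) (by omega)
  have h2 : l * m (idx p 0) ≤ 0 := mul_nonpos_of_nonpos_of_nonneg hl h0.le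
  rw [hg', hc0] at h1
  push_cast at h1
  have : (0 : ℤ) ≤ e := by positivity
  linarith

/-- Two candidates for w, or for z, differ by a multiple of the form excluded by `eq_zero_of_g_eq`;
the other parameters are then determined by the equations. -/
theorem IsParams.unique (hm : IsAlmostArithmetic m) {d d' : Params} (h : IsParams m d)
    (h' : IsParams m d') : d = d' := by
  have hp := hm.one_le
  have hpos := hm.pos
  obtain ⟨e, he0, he⟩ := hm.arith
  have h0 : (m (idx p 0) : ℤ) ≠ 0 := by exact_mod_cast (hpos _).ne'
  obtain ⟨u, v, w, z, l, mu, nu⟩ := d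
  obtain ⟨u', v', w', z', l', mu', nu'⟩ := d'
  obtain ⟨hu, hv, hw, hz, h1, h2, h3, h4, h5, h6⟩ := h
  obtain ⟨hu', hv', hw', hz', h1', h2', h3', h4', h5', h6'⟩ := h'
  dsimp only at *
  obtain rfl := hu.unique hu'
  obtain rfl := hv.unique hv'
  have aux := fun {s c : ℕ} {k : ℤ} => eq_zero_of_g_eq hp he hpos hu hv (s := s) (c := c) (k := k)
  have hu0 : 0 < u := by omega
  have hv0 : 0 < v := by omega
  obtain rfl : w = w' := by
    rcases le_total w w' with hle | hle
    · have := (aux (s := 0) (c := w' - w) (k := l' - l) hu0 (by omega) (by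
        rw [Nat.cast_sub hle]; push_cast; linear_combination h3' - h3)).2
      omega
    · have := (aux (s := 0) (c := w - w') (k := l - l') hu0 (by omega) (by
        rw [Nat.cast_sub hle]; push_cast; linear_combination h3 - h3')).2
      omega
  obtain rfl : z = z' := by
    rw [g_eq hp he] at h4 h4'
    rcases le_total z z' with hle | hle
    · have := (aux (s := z' - z) (c := 0) (k := mu + (quo p z + 1) - (mu' + (quo p z' + 1)))
        (by omega) hv0 (by
        rw [Nat.cast_sub hle]; push_cast; linear_combination h4 - h4')).1
      omega
    · have := (aux (s := z - z') (c := 0) (k := mu' + (quo p z' + 1) - (mu + (quo p z + 1)))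
        (by omega) hv0 (by
        rw [Nat.cast_sub hle]; push_cast; linear_combination h4' - h4)).1
      omega
  obtain rfl : l = l' := by
    have : (l : ℤ) = l' := mul_right_cancel₀ h0 (by linear_combination h3' - h3)
    exact_mod_cast this
  obtain rfl : mu = mu' := by
    have : (mu : ℤ) = mu' := mul_right_cancel₀ h0 (by linear_combination h4' - h4)
    exact_mod_cast this
  rw [h6, h6']

/-- The residues of `t e + b m_n` modulo `m_0` are distinct on the region that the leading
monomials of the generators cut out. -/
theorem IsParams.eq_of_residue_eq (hm : IsAlmostArithmetic m) {d : Params} (h : IsParams m d)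
    (he : ∀ k ≤ p, m (idx p k) = m (idx p 0) + k * e) {t b t' b' : ℕ} {k : ℤ}
    (ht : t < d.u) (hb : b < d.v) (htb : ¬ (d.u - d.z ≤ t ∧ d.v - d.w ≤ b))
    (ht' : t' < d.u) (hb' : b' < d.v) (htb' : ¬ (d.u - d.z ≤ t' ∧ d.v - d.w ≤ b'))
    (hk : (t : ℤ) * e + b * m (idx p (p + 1)) =
      t' * e + b' * m (idx p (p + 1)) + k * m (idx p 0)) : t = t' ∧ b = b' := by
  have hp := hm.one_le
  have hpos := hm.pos
  wlog htt : t' ≤ t generalizing t b t' b' k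
  · have := this (k := -k) ht' hb' htb' ht hb htb (by linear_combination -hk) (by omega)
    omega
  have aux := fun {s c : ℕ} {k : ℤ} =>
    eq_zero_of_g_eq hp he hpos h.u_least h.v_least (s := s) (c := c) (k := k)
  obtain ⟨s, rfl⟩ := Nat.exists_eq_add_of_le htt
  rcases le_total b b' with hbb | hbb
  · obtain ⟨c, rfl⟩ := Nat.exists_eq_add_of_le hbb
    push_cast at hk
    have := aux (s := s) (c := c) (k := k) (by omega) (by omega) (by linear_combination hk)
    omega
  · obtain ⟨c, rfl⟩ := Nat.exists_eq_add_of_le hbb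
    push_cast at hk
    have hu := h.g_u
    have hv := h.v_mul
    rw [g_eq hp he] at hu hv
    have hz := h.z_lt
    have hw := h.w_lt
    rcases Nat.eq_zero_or_pos s with rfl | hs
    · have := aux (s := 0) (c := c) (k := -k) (by omega) (by omega) (by
        push_cast; linear_combination -hk)
      omega
    rcases Nat.eq_zero_or_pos c with rfl | hc
    · have := aux (s := s) (c := 0) (k := k) (by omega) (by omega) (by
        push_cast; linear_combination hk)
      omega
    -- Here s e + c m_n ≡ 0 modulo m_0. Subtracting this from u e ≡ w m_n gives (u - s) e ≡ (w + c)
    -- m_n, which is excluded if w + c < υ.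
    have h1 : d.v - d.w ≤ c := by
      by_contra hcon
      have := aux (s := d.u - s) (c := d.w + c) (k := d.lam - (quo p d.u + 1) - k)
        (by omega) (by omega) (by
          rw [Nat.cast_sub (by omega)]; push_cast; linear_combination hu - hk)
      omega
    -- Likewise υ m_n ≡ z e gives (z + s) e ≡ (υ - c) m_n, excluded if z + s < u. Together the two
    -- bounds put (t, b) in the forbidden corner.
    have h2 : d.u - d.z ≤ s := by
      by_contra hcon
      have := aux (s := d.z + s) (c := d.v - c) (k := k - d.mu - (quo p d.z + 1))
        (by omega) (by omega) (by
          rw [Nat.cast_sub (by omega)]; push_cast; linear_combination hk - hv)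
      omega
    exact absurd ⟨by omega, by omega⟩ htb

end Numbers

/-! ### Indices of the variables -/

theorem idx_eq_idx_iff {p k l : ℕ} (hk : k ≤ p + 1) (hl : l ≤ p + 1) :
    idx p k = idx p l ↔ k = l := by
  rw [Fin.ext_iff]
  simp [idx, Nat.mod_eq_of_lt (show k < p + 2 by omega), Nat.mod_eq_of_lt (show l < p + 2 by omega)]

theorem le_of_le_idx {p k l : ℕ} (hk : k ≤ p + 1) (hl : l ≤ p + 1) (h : idx p k ≤ idx p l) :
    k ≤ l := by
  rw [Fin.le_def] at h
  simpa [idx, Nat.mod_eq_of_lt (show k < p + 2 by omega),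
    Nat.mod_eq_of_lt (show l < p + 2 by omega)] using h

theorem single_idx_apply {p k l n : ℕ} (hk : k ≤ p + 1) (hl : l ≤ p + 1) :
    Finsupp.single (idx p k) n (idx p l) = if k = l then n else 0 := by
  rw [Finsupp.single_apply]
  simp only [idx_eq_idx_iff hk hl]

/-! ### Binomials in the toric ideal -/

section Binomials

open scoped MonomialOrder

variable {K : Type*} [Field K] {p : ℕ} {m : Fin (p + 2) → ℕ}

/-- `x^A - x^B` lies in the toric ideal and has leading monomial `x^A`. -/
def IsRelation (m : Fin (p + 2) → ℕ) (A B : Fin (p + 2) →₀ ℕ) : Prop :=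
  Finsupp.weight m A = Finsupp.weight m B ∧ ∃ i, 0 < B i ∧ ∀ j ≤ i, A j = 0

/-- The first variable occurring in x^B precedes every variable of x^A, and in a reverse
lexicographic order this makes x^B the smaller term. -/
theorem IsRelation.lt {A B : Fin (p + 2) →₀ ℕ} (h : IsRelation m A B) (hm : ∀ i, 0 < m i) :
    B ≺[wgrevlex m hm] A := by
  classical
  obtain ⟨hw, i, hi, hA⟩ := h
  have hex : ∃ i, 0 < B i := ⟨i, hi⟩
  rw [wgrevlex_lt_iff]
  right
  constructor
  · simpa [Finsupp.weight_apply, Finsupp.sum_fintype] using hw.symm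
  · have hne : (Finset.univ.filter fun j => 0 < B j).Nonempty := ⟨i, by simpa using hi⟩
    set l := (Finset.univ.filter fun j => 0 < B j).min' hne
    have hl : 0 < B l := by simpa using Finset.min'_mem _ hne
    have hmin : ∀ j, 0 < B j → l ≤ j := fun j hj => Finset.min'_le _ j (by simpa using hj)
    refine ⟨l, fun j hj => ?_, ?_⟩
    · rw [hA j (hj.le.trans (hmin i hi))]
      by_contra hcon
      exact absurd (hmin j (by omega)) (not_le.2 hj)
    · rw [hA l (hmin i hi)]
      exact hl

theorem aeval_monomial_eq (A : Fin (p + 2) →₀ ℕ) (c : K) :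
    aeval (fun i => (Polynomial.X : Polynomial K) ^ m i) (monomial A c) =
      Polynomial.monomial (Finsupp.weight m A) c := by
  rw [aeval_monomial, Finsupp.weight_apply, Finsupp.prod, Finsupp.sum]
  simp only [← pow_mul, Finset.prod_pow_eq_pow_sum, smul_eq_mul]
  rw [← Polynomial.C_mul_X_pow_eq_monomial]
  simp [mul_comm]

theorem IsRelation.mem_toricIdeal {A B : Fin (p + 2) →₀ ℕ} (h : IsRelation m A B) :
    (monomial A 1 - monomial B 1 : MvPolynomial (Fin (p + 2)) K) ∈ toricIdeal K m := by
  rw [toricIdeal, RingHom.mem_ker, map_sub]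
  change aeval _ _ - aeval _ _ = _
  rw [aeval_monomial_eq, aeval_monomial_eq, h.1, sub_self]

theorem IsRelation.degree_eq {A B : Fin (p + 2) →₀ ℕ} (h : IsRelation m A B)
    (hm : ∀ i, 0 < m i) :
    (wgrevlex m hm).degree (monomial A 1 - monomial B 1 : MvPolynomial (Fin (p + 2)) K) = A := by
  classical
  have h1 : (wgrevlex m hm).degree (monomial B 1 : MvPolynomial (Fin (p + 2)) K)
      ≺[wgrevlex m hm] (wgrevlex m hm).degree (monomial A 1 : MvPolynomial (Fin (p + 2)) K) := by
    simpa [MonomialOrder.degree_monomial] using h.lt hm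
  rw [MonomialOrder.degree_sub_of_lt h1]
  simp [MonomialOrder.degree_monomial]

theorem IsRelation.leadingCoeff_eq {A B : Fin (p + 2) →₀ ℕ} (h : IsRelation m A B)
    (hm : ∀ i, 0 < m i) :
    (wgrevlex m hm).leadingCoeff
      (monomial A 1 - monomial B 1 : MvPolynomial (Fin (p + 2)) K) = 1 := by
  classical
  have h1 : (wgrevlex m hm).degree (monomial B 1 : MvPolynomial (Fin (p + 2)) K)
      ≺[wgrevlex m hm] (wgrevlex m hm).degree (monomial A 1 : MvPolynomial (Fin (p + 2)) K) := by
    simpa [MonomialOrder.degree_monomial] using h.lt hm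
  rw [MonomialOrder.leadingCoeff_sub_of_lt h1, MonomialOrder.leadingCoeff_monomial]

/-- The leading exponent of an element of the toric ideal is not the only exponent of its weight. -/
theorem exists_lt_of_mem_toricIdeal (hm : ∀ i, 0 < m i) {f : MvPolynomial (Fin (p + 2)) K}
    (hf : f ∈ toricIdeal K m) (h0 : f ≠ 0) :
    ∃ b, Finsupp.weight m b = Finsupp.weight m ((wgrevlex m hm).degree f) ∧
      b ≺[wgrevlex m hm] (wgrevlex m hm).degree f := by
  classical
  set a := (wgrevlex m hm).degree f
  have ha : a ∈ f.support := MonomialOrder.degree_mem_support h0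
  by_contra! hcon
  have h1 : aeval (fun i => (Polynomial.X : Polynomial K) ^ m i) f = 0 := hf
  rw [f.as_sum, map_sum] at h1
  -- If the leading exponent were alone in its weight, its coefficient would survive as a
  -- coefficient of the image in K[t].
  have h2 := congrArg (fun P => Polynomial.coeff P (Finsupp.weight m a)) h1
  simp only [aeval_monomial_eq, Polynomial.finsetSum_coeff, Polynomial.coeff_monomial,
    Polynomial.coeff_zero] at h2
  rw [Finset.sum_eq_single a] at h2
  · rw [if_pos rfl] at h2
    exact (mem_support_iff.1 ha) h2
  · intro b hb hba
    rw [if_neg]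
    intro hw
    have h3 := hcon b hw
    have h4 := (wgrevlex m hm).le_degree hb
    exact hba ((wgrevlex m hm).toSyn.injective (le_antisymm h4 h3))
  · exact fun h => absurd ha h

/-- A finite set of monic binomials in the toric ideal is a Gröbner basis as soon as the exponents
that no leading monomial divides have distinct weights. -/
theorem isGroebnerBasis_of_relations (hm : ∀ i, 0 < m i)
    (R : Set ((Fin (p + 2) →₀ ℕ) × (Fin (p + 2) →₀ ℕ)))
    {G : Set (MvPolynomial (Fin (p + 2)) K)} (hfin : G.Finite)
    (hR : ∀ r ∈ R, IsRelation m r.1 r.2)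
    (hG : G = (fun r => monomial r.1 1 - monomial r.2 1) '' R)
    (hstd : ∀ a b : Fin (p + 2) →₀ ℕ, (∀ r ∈ R, ¬ r.1 ≤ a) → (∀ r ∈ R, ¬ r.1 ≤ b) →
      Finsupp.weight m a = Finsupp.weight m b → a = b) :
    IsGroebnerBasis (wgrevlex m hm) G (toricIdeal K m) := by
  have hGI : G ⊆ toricIdeal K m := by
    rw [hG]
    rintro _ ⟨r, hr, rfl⟩
    exact (hR r hr).mem_toricIdeal
  refine ⟨hfin, hGI, le_antisymm (Ideal.span_mono (Set.image_mono hGI)) ?_⟩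
  rw [Ideal.span_le]
  rintro _ ⟨f, hf, rfl⟩
  by_cases h0 : f = 0
  · rw [h0, MonomialOrder.leadingTerm_zero]
    exact zero_mem _
  set a := (wgrevlex m hm).degree f
  obtain ⟨r, hr, hra⟩ : ∃ r ∈ R, r.1 ≤ a := by
    by_contra! hcon
    obtain ⟨c, hcw, hca⟩ := exists_lt_of_mem_toricIdeal hm hf h0
    -- The least exponent of the given weight is standard, since rewriting by a relation would lower
    -- it within that weight. By `hstd` it equals the leading exponent `a`, yet `c` is smaller.
    let T : Set (wgrevlex m hm).syn :=
      {s | Finsupp.weight m ((wgrevlex m hm).toSyn.symm s) = Finsupp.weight m a}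
    have hT : T.Nonempty := ⟨(wgrevlex m hm).toSyn c, by simpa [T] using hcw⟩
    obtain ⟨s, hs, hmin⟩ := WellFounded.has_min (wellFounded_lt (α := (wgrevlex m hm).syn)) T hT
    set b := (wgrevlex m hm).toSyn.symm s with hb
    have hbs : (wgrevlex m hm).toSyn b = s := by simp [hb]
    have hab : a = b := by
      refine hstd a b hcon (fun r hr hrb => ?_) hs.symm
      refine hmin ((wgrevlex m hm).toSyn (b - r.1 + r.2)) ?_ ?_
      · change Finsupp.weight m ((wgrevlex m hm).toSyn.symm ((wgrevlex m hm).toSyn _)) = _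
        rw [AddEquiv.symm_apply_apply, map_add, ← (hR r hr).1, ← map_add, tsub_add_cancel_of_le hrb]
        exact hs
      · rw [← hbs]
        conv_rhs => rw [← tsub_add_cancel_of_le hrb]
        rw [map_add, map_add]
        exact add_lt_add_right ((hR r hr).lt hm) _
    refine hmin ((wgrevlex m hm).toSyn c) ?_ ?_
    · change Finsupp.weight m ((wgrevlex m hm).toSyn.symm ((wgrevlex m hm).toSyn _)) = _
      rw [AddEquiv.symm_apply_apply, hcw]
    · rw [← hbs, ← hab]
      exact hca
  have hmem : (wgrevlex m hm).leadingTerm (monomial r.1 1 - monomial r.2 1) ∈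
      Ideal.span ((wgrevlex m hm).leadingTerm '' G) :=
    Ideal.subset_span ⟨_, hG ▸ ⟨r, hr, rfl⟩, rfl⟩
  rw [MonomialOrder.leadingTerm, (hR r hr).degree_eq hm, (hR r hr).leadingCoeff_eq hm] at hmem
  have h1 : (wgrevlex m hm).leadingTerm f =
      monomial (a - r.1) ((wgrevlex m hm).leadingCoeff f) * monomial r.1 1 := by
    rw [monomial_mul, mul_one, tsub_add_cancel_of_le hra, MonomialOrder.leadingTerm]
  rw [h1]
  exact Ideal.mul_mem_left _ _ hmem

end Binomials

/-! ### Exponents of the Patil–Singh generators -/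

section Exponents

variable {p : ℕ} {m : Fin (p + 2) → ℕ} {e : ℕ}

/-- The exponent of `x_{r_t} x_p ^ {q_t}`. -/
noncomputable def gExp (p t : ℕ) : Fin (p + 2) →₀ ℕ :=
  if t = 0 then 0
  else Finsupp.single (idx p (rem p t)) 1 + Finsupp.single (idx p p) (quo p t).toNat

theorem weight_gExp (hp : 1 ≤ p) (he : ∀ k ≤ p, m (idx p k) = m (idx p 0) + k * e) (t : ℕ) :
    (Finsupp.weight m (gExp p t) : ℤ) = g m t := by
  rcases Nat.eq_zero_or_pos t with rfl | h
  · simp [gExp, g_zero hp he]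
  · rw [gExp, if_neg (by omega), map_add, Finsupp.weight_single, Finsupp.weight_single, g]
    push_cast
    simp only [smul_eq_mul, one_mul]
    push_cast
    rw [Int.toNat_of_nonneg (quo_nonneg t h)]
    ring

/-- The exponents that are divisible by no `x_i x_j` with `1 ≤ i ≤ j ≤ p - 1`. -/
theorem exists_eq_gExp (hp : 1 ≤ p) (a : Fin (p + 2) →₀ ℕ)
    (ha : ∀ i j, 1 ≤ i → i ≤ j → j ≤ p - 1 →
      ¬ Finsupp.single (idx p i) 1 + Finsupp.single (idx p j) 1 ≤ a) :
    ∃ t, a = Finsupp.single (idx p 0) (a (idx p 0)) + gExp p t +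
      Finsupp.single (idx p (p + 1)) (a (idx p (p + 1))) := by
  by_cases h : ∃ i, 1 ≤ i ∧ i ≤ p - 1 ∧ 0 < a (idx p i)
  · obtain ⟨i, hi1, hip, hi⟩ := h
    -- At most one of x_1, …, x_{p-1} occurs, with exponent 1. Its index is r_t and the exponent of
    -- x_p is q_t.
    obtain ⟨hq, hr⟩ := quo_rem_unique hp (a (idx p p) * p + i) (a (idx p p)) i (by push_cast; rfl)
      hi1 (by omega)
    have hone : a (idx p i) = 1 := by
      by_contra hcon
      refine ha i i hi1 le_rfl hip ?_
      rw [← Finsupp.single_add, Finsupp.single_le_iff]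
      omega
    have hzero : ∀ j, 1 ≤ j → j ≤ p - 1 → j ≠ i → a (idx p j) = 0 := by
      intro j hj1 hjp hji
      by_contra hcon
      have key : ∀ k l, 1 ≤ k → k < l → l ≤ p - 1 → a (idx p k) ≠ 0 → a (idx p l) ≠ 0 → False := by
        intro k l hk hkl hl hak hal
        refine ha k l hk hkl.le hl fun s => ?_
        obtain ⟨n, hn, rfl⟩ := exists_idx_eq s
        rw [Finsupp.add_apply, single_idx_apply (by omega) hn, single_idx_apply (by omega) hn]
        split_ifs with h1 h2 h2
        · omega
        · subst h1; omega
        · subst h2; omega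
        · omega
      rcases Nat.lt_or_gt_of_ne hji with h | h
      · exact key j i hj1 h hip hcon (by omega)
      · exact key i j hi1 h hjp (by omega) hcon
    refine ⟨a (idx p p) * p + i, ?_⟩
    rw [gExp, if_neg (by omega), ← hq, ← hr]
    ext s
    obtain ⟨n, hn, rfl⟩ := exists_idx_eq s
    simp only [Finsupp.add_apply]
    rw [single_idx_apply (by omega) hn, single_idx_apply (by omega) hn,
      single_idx_apply (by omega) hn, single_idx_apply (by omega) hn, Int.toNat_natCast]
    by_cases h0 : n = 0
    · subst h0; simp; omega
    by_cases h1 : n = i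
    · rw [h1, hone]; split_ifs <;> omega
    by_cases h2 : n = p
    · rw [h2]; split_ifs <;> omega
    by_cases h3 : n = p + 1
    · subst h3; simp; omega
    rw [hzero n (by omega) (by omega) h1, if_neg (Ne.symm h0), if_neg (Ne.symm h1),
      if_neg (Ne.symm h2), if_neg (Ne.symm h3)]
    rfl
  · push Not at h
    -- With only x_p left, one factor x_p plays the role of x_{r_t}, so r_t = p and q_t is one less
    -- than the exponent; t = 0 covers exponent 0.
    refine ⟨a (idx p p) * p, ?_⟩
    have hgp : gExp p (a (idx p p) * p) = Finsupp.single (idx p p) (a (idx p p)) := by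
      rcases Nat.eq_zero_or_pos (a (idx p p)) with hc | hc
      · simp [gExp, hc]
      · obtain ⟨hq, hr⟩ := quo_rem_unique hp (a (idx p p) * p) (a (idx p p) - 1) p
          (by push_cast; ring) hp le_rfl
        rw [gExp, if_neg (by positivity), ← hq, ← hr, ← Finsupp.single_add]
        congr 1
        omega
    rw [hgp]
    ext s
    obtain ⟨n, hn, rfl⟩ := exists_idx_eq s
    simp only [Finsupp.add_apply]
    rw [single_idx_apply (by omega) hn, single_idx_apply (by omega) hn,
      single_idx_apply (by omega) hn]
    by_cases h0 : n = 0
    · subst h0; simp; omega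
    by_cases h2 : n = p
    · subst h2; simp; omega
    by_cases h3 : n = p + 1
    · subst h3; simp
    have := h n (by omega) (by omega)
    rw [if_neg (by omega), if_neg (by omega), if_neg (by omega)]
    omega

/-- If q_t = q_u, then r_t ≥ r_u and i = r_t - r_u works. If q_t > q_u, there is an extra factor
x_p, and i = p - r_u works. -/
theorem exists_le_gExp (hp : 1 ≤ p) {u t : ℕ} (hu : 1 ≤ u) (hut : u ≤ t) :
    ∃ i ≤ p - rem p u, Finsupp.single (idx p (rem p u + i)) 1 +
      Finsupp.single (idx p p) (quo p u).toNat ≤ gExp p t := by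
  obtain ⟨hu1, hu2, hu3⟩ := quo_rem_spec hp u
  obtain ⟨ht1, ht2, ht3⟩ := quo_rem_spec hp t
  have hq0 := quo_nonneg (p := p) u hu
  have hqm := quo_mono hp hut
  rw [gExp, if_neg (by omega)]
  rcases hqm.eq_or_lt with h | h
  · rw [← h]
    rw [← h] at ht1
    refine ⟨rem p t - rem p u, by omega, ?_⟩
    rw [Nat.add_sub_cancel' (by omega)]
  · refine ⟨p - rem p u, le_rfl, ?_⟩
    rw [Nat.add_sub_cancel' (by omega), ← Finsupp.single_add, Finsupp.single_le_iff,
      Finsupp.add_apply, Finsupp.single_eq_same]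
    omega

theorem single_add_gExp_le {a b t c : ℕ} {A : Fin (p + 2) →₀ ℕ} (hA : A ≤ gExp p t)
    (hc : c ≤ b) : A + Finsupp.single (idx p (p + 1)) c ≤
      Finsupp.single (idx p 0) a + gExp p t + Finsupp.single (idx p (p + 1)) b :=
  add_le_add (hA.trans le_add_self) (Finsupp.single_mono hc)

end Exponents

/-! ### The generators as binomials and their leading monomials -/

section Generators

variable {p : ℕ} {m : Fin (p + 2) → ℕ}

/-- The exponents of the two terms of `φ_i`. -/
noncomputable def phiExp (p : ℕ) (d : Params) (i : ℕ) :
    (Fin (p + 2) →₀ ℕ) × (Fin (p + 2) →₀ ℕ) :=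
  (Finsupp.single (idx p (rem p d.u + i)) 1 + Finsupp.single (idx p p) (quo p d.u).toNat,
    Finsupp.single (idx p 0) (d.lam - 1) + Finsupp.single (idx p i) 1 +
      Finsupp.single (idx p (p + 1)) d.w)

/-- The exponents of the two terms of `ψ_j`. -/
noncomputable def psiExp (p : ℕ) (d : Params) (j : ℕ) :
    (Fin (p + 2) →₀ ℕ) × (Fin (p + 2) →₀ ℕ) :=
  (Finsupp.single (idx p (rem p (d.u - d.z) + j)) 1 +
      Finsupp.single (idx p p) (quo p (d.u - d.z)).toNat +
      Finsupp.single (idx p (p + 1)) (d.v - d.w),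
    Finsupp.single (idx p 0) (d.nu - 1) + Finsupp.single (idx p j) 1)

/-- The exponents of the two terms of `θ`. -/
noncomputable def thetaExp (p : ℕ) (d : Params) :
    (Fin (p + 2) →₀ ℕ) × (Fin (p + 2) →₀ ℕ) :=
  (Finsupp.single (idx p (p + 1)) d.v, Finsupp.single (idx p 0) d.mu + gExp p d.z)

/-- The exponents of the two terms of `ξ_{i,j}`. -/
noncomputable def xiExp (p i j : ℕ) : (Fin (p + 2) →₀ ℕ) × (Fin (p + 2) →₀ ℕ) :=
  (Finsupp.single (idx p i) 1 + Finsupp.single (idx p j) 1,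
    if i + j ≤ p then Finsupp.single (idx p 0) 1 + Finsupp.single (idx p (i + j)) 1
    else Finsupp.single (idx p (i + j - p)) 1 + Finsupp.single (idx p p) 1)

/-- The binomial with the given pair of exponents. -/
noncomputable def binomial (K : Type*) [Field K] {p : ℕ}
    (r : (Fin (p + 2) →₀ ℕ) × (Fin (p + 2) →₀ ℕ)) : MvPolynomial (Fin (p + 2)) K :=
  monomial r.1 1 - monomial r.2 1

theorem single_monomial_eq (K : Type*) [Field K] (p k n : ℕ) :
    monomial (Finsupp.single (idx p k) n) (1 : K) = x K p k ^ n :=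
  X_pow_eq_monomial.symm

theorem add_monomial_eq {K : Type*} [Field K] (A B : Fin (p + 2) →₀ ℕ) :
    monomial (A + B) (1 : K) = monomial A 1 * monomial B 1 := by
  rw [monomial_mul, one_mul]

theorem gMonomial_eq (K : Type*) [Field K] (p t : ℕ) :
    gMonomial K p t = monomial (gExp p t) 1 := by
  unfold gMonomial gExp
  split_ifs
  · rfl
  · rw [add_monomial_eq, single_monomial_eq, single_monomial_eq, pow_one]

theorem phi_eq (K : Type*) [Field K] (p : ℕ) (d : Params) (i : ℕ) :
    phi K p d i = binomial K (phiExp p d i) := by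
  simp only [phi, binomial, phiExp, add_monomial_eq, single_monomial_eq, pow_one]

theorem psi_eq (K : Type*) [Field K] (p : ℕ) (d : Params) (j : ℕ) :
    psi K p d j = binomial K (psiExp p d j) := by
  simp only [psi, binomial, psiExp, add_monomial_eq, single_monomial_eq, pow_one]

theorem theta_eq (K : Type*) [Field K] (p : ℕ) (d : Params) :
    theta K p d = binomial K (thetaExp p d) := by
  simp only [theta, binomial, thetaExp, add_monomial_eq, single_monomial_eq, gMonomial_eq]

theorem xi_eq (K : Type*) [Field K] (p i j : ℕ) :
    xi K p i j = binomial K (xiExp p i j) := by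
  unfold xi binomial xiExp
  split_ifs <;> simp only [add_monomial_eq, single_monomial_eq, pow_one]

/-- The pairs of exponents of the Patil–Singh generators. -/
def relations (p : ℕ) (d : Params) : Set ((Fin (p + 2) →₀ ℕ) × (Fin (p + 2) →₀ ℕ)) :=
  {r | ∃ i, i ≤ p - rem p d.u ∧ r = phiExp p d i} ∪
  {r | ∃ j, j ≤ p - rem p (d.u - d.z) ∧ r = psiExp p d j} ∪
  {thetaExp p d} ∪
  {r | ∃ i j, 1 ≤ i ∧ i ≤ j ∧ j ≤ p - 1 ∧ r = xiExp p i j}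

theorem generators_eq (K : Type*) [Field K] (p : ℕ) (d : Params) :
    generators K p d = binomial K '' relations p d := by
  ext f
  constructor
  · rintro (((⟨i, hi, rfl⟩ | ⟨i, hi, rfl⟩) | rfl) | ⟨i, j, hi, hij, hj, rfl⟩)
    · exact ⟨_, .inl (.inl (.inl ⟨i, hi, rfl⟩)), (phi_eq K p d i).symm⟩
    · exact ⟨_, .inl (.inl (.inr ⟨i, hi, rfl⟩)), (psi_eq K p d i).symm⟩
    · exact ⟨_, .inl (.inr rfl), (theta_eq K p d).symm⟩
    · exact ⟨_, .inr ⟨i, j, hi, hij, hj, rfl⟩, (xi_eq K p i j).symm⟩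
  · rintro ⟨r, ((⟨i, hi, rfl⟩ | ⟨i, hi, rfl⟩) | rfl) | ⟨i, j, hi, hij, hj, rfl⟩, rfl⟩
    · exact .inl (.inl (.inl ⟨i, hi, (phi_eq K p d i).symm⟩))
    · exact .inl (.inl (.inr ⟨i, hi, (psi_eq K p d i).symm⟩))
    · exact .inl (.inr (theta_eq K p d).symm)
    · exact .inr ⟨i, j, hi, hij, hj, (xi_eq K p i j).symm⟩

theorem relations_finite (p : ℕ) (d : Params) : (relations p d).Finite := by
  have h1 : ((phiExp p d '' Set.Iic (p - rem p d.u)) ∪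
      (psiExp p d '' Set.Iic (p - rem p (d.u - d.z))) ∪ {thetaExp p d} ∪
      ((fun ij : ℕ × ℕ => xiExp p ij.1 ij.2) '' (Set.Iic (p - 1) ×ˢ Set.Iic (p - 1)))).Finite :=
    ((((Set.finite_Iic _).image _).union ((Set.finite_Iic _).image _)).union
      (Set.finite_singleton _)).union (((Set.finite_Iic _).prod (Set.finite_Iic _)).image _)
  refine h1.subset ?_
  rintro _ (((⟨i, hi, rfl⟩ | ⟨i, hi, rfl⟩) | rfl) | ⟨i, j, hi, hij, hj, rfl⟩)
  · exact .inl (.inl (.inl ⟨i, hi, rfl⟩))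
  · exact .inl (.inl (.inr ⟨i, hi, rfl⟩))
  · exact .inl (.inr rfl)
  · exact .inr ⟨(i, j), ⟨hij.trans hj, hj⟩, rfl⟩

variable {d : Params}

theorem phiExp_isRelation (hm : IsAlmostArithmetic m) (hd : IsParams m d) {i : ℕ}
    (hi : i ≤ p - rem p d.u) : IsRelation m (phiExp p d i).1 (phiExp p d i).2 := by
  have hp := hm.one_le
  obtain ⟨e, -, he⟩ := hm.arith
  obtain ⟨-, hr1, hr2⟩ := quo_rem_spec hp d.u
  have hz := hd.z_lt
  have hl := hd.one_le_lam
  constructor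
  · have h := hd.g_u
    -- The truncation in `toNat` is harmless: z < u gives u ≥ 1, so q_u ≥ 0.
    have hq := Int.toNat_of_nonneg (quo_nonneg (p := p) d.u (by omega))
    rw [g, ← hq, he _ hr2] at h
    simp only [phiExp, map_add, Finsupp.weight_single, smul_eq_mul, one_mul]
    rw [he (rem p d.u + i) (by omega), he i (by omega)]
    zify [hl]
    push_cast at h ⊢
    linear_combination h
  · refine ⟨idx p i, ?_, fun s hs => ?_⟩
    · simp [phiExp]
    · obtain ⟨n, hn, rfl⟩ := exists_idx_eq s
      have hni := le_of_le_idx hn (by omega) hs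
      simp only [phiExp, Finsupp.add_apply]
      rw [single_idx_apply (by omega) hn, single_idx_apply (by omega) hn, if_neg (by omega),
        if_neg (by omega)]

theorem psiExp_isRelation (hm : IsAlmostArithmetic m) (hd : IsParams m d) {j : ℕ}
    (hj : j ≤ p - rem p (d.u - d.z)) : IsRelation m (psiExp p d j).1 (psiExp p d j).2 := by
  have hp := hm.one_le
  obtain ⟨e, -, he⟩ := hm.arith
  obtain ⟨-, hr1, hr2⟩ := quo_rem_spec hp (d.u - d.z)
  have hz := hd.z_lt
  have hn := hd.two_le_nu
  have hw := hd.w_lt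
  constructor
  · have h := hd.g_u_sub_z
    have hq := Int.toNat_of_nonneg (quo_nonneg (p := p) (d.u - d.z) (by omega))
    rw [g, ← hq, he _ hr2] at h
    simp only [psiExp, map_add, Finsupp.weight_single, smul_eq_mul, one_mul]
    rw [he (rem p (d.u - d.z) + j) (by omega), he j (by omega)]
    zify [hw.le, show 1 ≤ d.nu by omega]
    push_cast at h ⊢
    linear_combination h
  · refine ⟨idx p j, ?_, fun s hs => ?_⟩
    · simp [psiExp]
    · obtain ⟨n, hn, rfl⟩ := exists_idx_eq s
      have hni := le_of_le_idx hn (by omega) hs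
      simp only [psiExp, Finsupp.add_apply]
      rw [single_idx_apply (by omega) hn, single_idx_apply (by omega) hn,
        single_idx_apply (by omega) hn, if_neg (by omega), if_neg (by omega), if_neg (by omega)]

theorem thetaExp_isRelation (hm : IsAlmostArithmetic m) (hd : IsParams m d) :
    IsRelation m (thetaExp p d).1 (thetaExp p d).2 := by
  have hp := hm.one_le
  obtain ⟨e, -, he⟩ := hm.arith
  have hv := hd.w_lt
  have h := hd.v_mul
  constructor
  · rw [← weight_gExp hp he] at h
    simp only [thetaExp, map_add, Finsupp.weight_single, smul_eq_mul]
    exact_mod_cast h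
  -- The second term involves some variable below x_n. If z = 0 this has to be x_0, and μ = 0 would
  -- give υ m_n = 0.
  · have key : ∃ k ≤ p, 0 < (thetaExp p d).2 (idx p k) := by
      rcases Nat.eq_zero_or_pos d.z with hz | hz
      · refine ⟨0, by omega, ?_⟩
        have hmu : d.mu ≠ 0 := by
          intro h0
          rw [h0, hz, g_zero hp he] at h
          have h1 : (0 : ℤ) < d.v * m (idx p (p + 1)) :=
            mul_pos (by omega) (by exact_mod_cast hm.pos _)
          simp at h
          rcases h with h | h
          · omega
          · have := hm.pos (idx p (p + 1))
            omega
        simp [thetaExp]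
        omega
      · refine ⟨rem p d.z, (quo_rem_spec hp d.z).2.2, ?_⟩
        rw [thetaExp, gExp, if_neg (by omega)]
        simp
    obtain ⟨k, hk, hpos⟩ := key
    refine ⟨idx p k, hpos, fun s hs => ?_⟩
    obtain ⟨n, hn, rfl⟩ := exists_idx_eq s
    have hni := le_of_le_idx hn (by omega) hs
    simp only [thetaExp]
    rw [single_idx_apply (by omega) hn, if_neg (by omega)]

theorem xiExp_isRelation (hm : IsAlmostArithmetic m) {i j : ℕ} (hi : 1 ≤ i) (hij : i ≤ j)
    (hj : j ≤ p - 1) : IsRelation m (xiExp p i j).1 (xiExp p i j).2 := by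
  obtain ⟨e, -, he⟩ := hm.arith
  have hp := hm.one_le
  constructor
  · unfold xiExp
    split_ifs with h
    · simp only [map_add, Finsupp.weight_single, smul_eq_mul, one_mul]
      rw [he i (by omega), he j (by omega), he (i + j) h]
      ring
    · simp only [map_add, Finsupp.weight_single, smul_eq_mul, one_mul]
      rw [he i (by omega), he j (by omega), he (i + j - p) (by omega), he p le_rfl]
      zify [show p ≤ i + j by omega]
      ring
  -- In the second case the smaller index is i + j - p, which is below i because j < p.
  · have key : ∃ k < i, 0 < (xiExp p i j).2 (idx p k) := by
      unfold xiExp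
      split_ifs with h
      · exact ⟨0, by omega, by simp⟩
      · exact ⟨i + j - p, by omega, by simp⟩
    obtain ⟨k, hk, hpos⟩ := key
    refine ⟨idx p k, hpos, fun s hs => ?_⟩
    obtain ⟨n, hn, rfl⟩ := exists_idx_eq s
    have hni := le_of_le_idx hn (by omega) hs
    simp only [xiExp, Finsupp.add_apply]
    rw [single_idx_apply (by omega) hn, single_idx_apply (by omega) hn, if_neg (by omega),
      if_neg (by omega)]

theorem relations_isRelation (hm : IsAlmostArithmetic m) (hd : IsParams m d) :
    ∀ r ∈ relations p d, IsRelation m r.1 r.2 := by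
  rintro _ (((⟨i, hi, rfl⟩ | ⟨i, hi, rfl⟩) | rfl) | ⟨i, j, hi, hij, hj, rfl⟩)
  · exact phiExp_isRelation hm hd hi
  · exact psiExp_isRelation hm hd hi
  · exact thetaExp_isRelation hm hd
  · exact xiExp_isRelation hm hi hij hj

/-- The shape of the exponents that no leading monomial divides. -/
theorem exists_standard_form (hm : IsAlmostArithmetic m) (hd : IsParams m d)
    (a : Fin (p + 2) →₀ ℕ) (ha : ∀ r ∈ relations p d, ¬ r.1 ≤ a) :
    ∃ c t b, a = Finsupp.single (idx p 0) c + gExp p t + Finsupp.single (idx p (p + 1)) b ∧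
      t < d.u ∧ b < d.v ∧ ¬ (d.u - d.z ≤ t ∧ d.v - d.w ≤ b) := by
  have hp := hm.one_le
  have hz := hd.z_lt
  obtain ⟨t, ht⟩ := exists_eq_gExp hp a fun i j hi hij hj =>
    ha (xiExp p i j) (.inr ⟨i, j, hi, hij, hj, rfl⟩)
  refine ⟨_, t, _, ht, ?_, ?_, ?_⟩
  · by_contra hcon
    obtain ⟨i, hi, hle⟩ := exists_le_gExp hp (by omega) (not_lt.1 hcon)
    refine ha (phiExp p d i) (.inl (.inl (.inl ⟨i, hi, rfl⟩))) ?_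
    rw [ht]
    exact hle.trans (le_add_self.trans le_self_add)
  · by_contra hcon
    refine ha (thetaExp p d) (.inl (.inr rfl)) ?_
    simp only [thetaExp]
    rw [Finsupp.single_le_iff]
    omega
  · rintro ⟨h1, h2⟩
    obtain ⟨j, hj, hle⟩ := exists_le_gExp hp (by omega) h1
    refine ha (psiExp p d j) (.inl (.inl (.inr ⟨j, hj, rfl⟩))) ?_
    rw [ht]
    exact single_add_gExp_le hle h2

theorem eq_of_weight_eq (hm : IsAlmostArithmetic m) (hd : IsParams m d)
    (a a' : Fin (p + 2) →₀ ℕ) (ha : ∀ r ∈ relations p d, ¬ r.1 ≤ a)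
    (ha' : ∀ r ∈ relations p d, ¬ r.1 ≤ a')
    (hw : Finsupp.weight m a = Finsupp.weight m a') : a = a' := by
  have hp := hm.one_le
  obtain ⟨e, -, he⟩ := hm.arith
  obtain ⟨c, t, b, rfl, h1, h2, h3⟩ := exists_standard_form hm hd a ha
  obtain ⟨c', t', b', rfl, h1', h2', h3'⟩ := exists_standard_form hm hd a' ha'
  have hw' := congrArg (Nat.cast : ℕ → ℤ) hw
  simp only [map_add, Finsupp.weight_single, smul_eq_mul] at hw'
  push_cast at hw'
  rw [weight_gExp hp he, weight_gExp hp he, g_eq hp he, g_eq hp he] at hw'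
  obtain ⟨rfl, rfl⟩ := hd.eq_of_residue_eq hm he
    (k := c' + (quo p t' + 1) - (c + (quo p t + 1))) h1 h2 h3 h1' h2' h3'
    (by linear_combination hw')
  -- Once t and b agree, the weight determines the exponent of x_0.
  have h0 : (m (idx p 0) : ℤ) ≠ 0 := by exact_mod_cast (hm.pos _).ne'
  have hc : (c : ℤ) = c' := mul_right_cancel₀ h0 (by linear_combination hw')
  obtain rfl : c = c' := by exact_mod_cast hc
  rfl

theorem generators_isGroebnerBasis (K : Type*) [Field K] (hm : IsAlmostArithmetic m)
    (hd : IsParams m d) :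
    IsGroebnerBasis (wgrevlex m hm.pos) (generators K p d) (toricIdeal K m) :=
  isGroebnerBasis_of_relations hm.pos (relations p d)
    (generators_eq K p d ▸ (relations_finite p d).image _) (relations_isRelation hm hd)
    (generators_eq K p d) (eq_of_weight_eq hm hd)

/-! ### A basis that is not minimal -/

/-- If `w = 0`, then the leading monomial of `θ` divides that of `ψ_0`. -/
theorem not_isMinimalGroebnerBasis_of_w_eq_zero (K : Type*) [Field K] (hm : IsAlmostArithmetic m)
    (hd : IsParams m d) (hw : d.w = 0) :
    ¬ IsMinimalGroebnerBasis (wgrevlex m hm.pos) (generators K p d) (toricIdeal K m) := by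
  rintro ⟨-, -, hmin⟩
  have hp := hm.one_le
  obtain ⟨-, hr1, hr2⟩ := quo_rem_spec hp (d.u - d.z)
  have hdψ : (wgrevlex m hm.pos).degree (psi K p d 0) = (psiExp p d 0).1 := by
    rw [psi_eq]
    exact (psiExp_isRelation hm hd (Nat.zero_le _)).degree_eq hm.pos
  have hdθ : (wgrevlex m hm.pos).degree (theta K p d) = (thetaExp p d).1 := by
    rw [theta_eq]
    exact (thetaExp_isRelation hm hd).degree_eq hm.pos
  have hne : theta K p d ≠ psi K p d 0 := by
    intro h
    rw [h, hdψ] at hdθ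
    have h1 := DFunLike.congr_fun hdθ (idx p (rem p (d.u - d.z)))
    simp only [psiExp, thetaExp, Finsupp.add_apply, add_zero, Finsupp.single_eq_same] at h1
    rw [single_idx_apply (l := rem p (d.u - d.z)) le_rfl (by omega),
      single_idx_apply (l := rem p (d.u - d.z)) le_rfl (by omega), if_neg (by omega),
      if_neg (by omega)] at h1
    omega
  refine hmin (psi K p d 0) (.inl (.inl (.inr ⟨0, Nat.zero_le _, rfl⟩))) ?_
  have hmem : monomial ((wgrevlex m hm.pos).degree (theta K p d)) (1 : K) ∈
      Ideal.span ((fun h => monomial ((wgrevlex m hm.pos).degree h) (1 : K)) ''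
        (generators K p d \ {psi K p d 0})) :=
    Ideal.subset_span ⟨_, ⟨.inl (.inr rfl), hne⟩, rfl⟩
  rw [hdθ] at hmem
  rw [hdψ]
  simp only [psiExp, hw, Nat.sub_zero]
  rw [add_monomial_eq]
  exact Ideal.mul_mem_left _ _ hmem

theorem isAlmostArithmetic_four_six_seven :
    IsAlmostArithmetic (p := 1) (![4, 6, 7] : Fin 3 → ℕ) where
  one_le := le_rfl
  pos i := by fin_cases i <;> simp
  arith := by
    refine ⟨2, by norm_num, fun k hk => ?_⟩
    interval_cases k <;> rfl
  gcd_eq_one := by decide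
  minimal i hi := by
    -- Each generator is separated from the semigroup of the other two by a predicate that is closed
    -- under addition.
    have key : ∀ P : ℕ → Prop, P 0 → (∀ a b, P a → P b → P (a + b)) →
        (∀ j, j ≠ i → P ((![4, 6, 7] : Fin 3 → ℕ) j)) → P ((![4, 6, 7] : Fin 3 → ℕ) i) := by
      intro P h0 hadd hgen
      refine AddSubmonoid.closure_induction (motive := fun y _ => P y) ?_ h0
        (fun a b _ _ ha hb => hadd a b ha hb) hi
      rintro _ ⟨j, hj, rfl⟩
      exact hgen j hj
    fin_cases i
    · have := key (fun a => a = 0 ∨ 6 ≤ a) (by omega) (by omega)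
        (by intro j hj; fin_cases j <;> simp_all)
      simp at this
    · have := key (fun a => a = 0 ∨ a = 4 ∨ 7 ≤ a) (by omega) (by omega)
        (by intro j hj; fin_cases j <;> simp_all)
      simp at this
    · have := key (fun a => a % 2 = 0) (by omega) (by omega)
        (by intro j hj; fin_cases j <;> simp_all)
      simp at this

theorem IsParams.w_eq_zero_four_six_seven {d : Params}
    (hd : IsParams (p := 1) (![4, 6, 7] : Fin 3 → ℕ) d) : d.w = 0 := by
  have he : ∀ k ≤ 1, (![4, 6, 7] : Fin 3 → ℕ) (idx 1 k) =
      (![4, 6, 7] : Fin 3 → ℕ) (idx 1 0) + k * 2 := by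
    intro k hk
    interval_cases k <;> rfl
  have h0 : (![4, 6, 7] : Fin 3 → ℕ) (idx 1 0) = 4 := rfl
  have h2 : (![4, 6, 7] : Fin 3 → ℕ) (idx 1 (1 + 1)) = 7 := rfl
  have hg : ∀ t, g (p := 1) (![4, 6, 7] : Fin 3 → ℕ) t = 6 * t := by
    intro t
    rw [g_eq le_rfl he, h0, quo]
    push_cast
    rw [Int.ediv_one]
    ring
  have hu : d.u ≤ 2 := hd.u_least.2 <| (notMem_apery_iff le_rfl he 2).2
    ⟨2, 0, 0, by rw [hg, hg, h0]; norm_num⟩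
  have h := hd.g_u
  rw [hg, h0, h2] at h
  have := hd.one_le_lam
  -- From u ≤ 2 and λ ≥ 1, the number 7w = 6u - 4λ is even and at most 8, so w = 0.
  omega

end Generators

end PatilSingh

theorem theorem3 (K : Type*) [Field K] :
    (∀ (p : ℕ) (m : Fin (p + 2) → ℕ) (hm : PatilSingh.IsAlmostArithmetic m),
      (∃! d : PatilSingh.Params, PatilSingh.IsParams m d) ∧
      ∀ d : PatilSingh.Params, PatilSingh.IsParams m d →
        PatilSingh.IsGroebnerBasis (PatilSingh.wgrevlex m hm.pos)
          (PatilSingh.generators K p d) (PatilSingh.toricIdeal K m)) ∧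
    (∃ (p : ℕ) (m : Fin (p + 2) → ℕ) (hm : PatilSingh.IsAlmostArithmetic m)
      (d : PatilSingh.Params), PatilSingh.IsParams m d ∧
        ¬ PatilSingh.IsMinimalGroebnerBasis (PatilSingh.wgrevlex m hm.pos)
          (PatilSingh.generators K p d) (PatilSingh.toricIdeal K m)) := by
  refine ⟨fun p m hm => ⟨?_, fun d hd => PatilSingh.generators_isGroebnerBasis K hm hd⟩, ?_⟩
  · obtain ⟨d, hd⟩ := PatilSingh.exists_isParams hm
    exact ⟨d, hd, fun d' hd' => hd'.unique hm hd⟩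
  · have hm := PatilSingh.isAlmostArithmetic_four_six_seven
    obtain ⟨d, hd⟩ := PatilSingh.exists_isParams hm
    exact ⟨1, ![4, 6, 7], hm, d, hd,
      PatilSingh.not_isMinimalGroebnerBasis_of_w_eq_zero K hm hd hd.w_eq_zero_four_six_seven⟩
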